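/- A seller with type \(x\in X=\{1,\dots,\bar x\}\) can sell an indivisible good to a buyer with type \(y\in Y=\{1,\dots,\bar y\}\). Types are private information and independent, with full-support laws \(p_1\) on \(X\) and \(p_2\) on \(Y\). Trader \(i\)'s valuation is \(v_i^1(x)+v_i^2(y)\ge 0\), where \(v_i^i\) is strictly increasing and \(v_i^j\) (\(j\neq i\)) is nondecreasing. At an outcome \((q,t)\in[0,1]\times\mathbb R\) (transfer probability, payment to the seller) the seller's payoff is \(t+(v_1^1(x)+v_1^2(y))(1-q)\) and the buyer's payoff is \((v_2^1(x)+v_2^2(y))q-t\); no trade is \((0,0)\). An allocation is a map \(g=(q,t):X\times Y\to[0,1]\times\mathbb R\), viewed as a direct mechanism; \(U_1^g(x)\) is the truthful interim payoff of seller type \(x\) (expectation over \(y\sim p_2\)). For \(\pi_1\in\Delta(X)\), \(g\) is \(\pi_1\)-feasible if it is Bayesian incentive compatible and interim individually rational for the seller (outside payoff \(v_1^1(x)+E_y[v_1^2(y)]\)) and for the buyer with belief \(\pi_1\) about \(x\) (outside payoff \(0\)); it is feasible if it is \(p_1\)-feasible. \(g'\) dominates \(g\) if \(U_1^{g'}\ge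 U_1^{g}\) at every type, with strict inequality at some type. A feasible allocation is undominated if no feasible allocation dominates it. An RSW allocation is an allocation that, for every \(x\) simultaneously, maximizes \(U_1^g(x)\) over all allocations \(g\) that are Bayesian incentive compatible for the seller and ex post incentive compatible and ex post individually rational for the buyer (at every \((x,y)\)). A strong solution is an undominated RSW allocation. A mechanism \(G\) consists of finite action sets \(S_1,S_2\) and an outcome function on \(S_1\times S_2\) with values in \([0,1]\times\mathbb R\). \(BR(\pi_1,G)\) is the set of allocations induced by sequential equilibria of the continuation game in which \(G\) has been offered and the buyer has belief \(\pi_1\) about \(x\): the buyer accepts or rejects, rejection gives no trade, and after acceptance both players simultaneously choose actions. An allocation \(g\) passes the Farrell–Grossman–Perry (FGP) criterion if \(g\) is feasible and there are no allocation \(g'\), mechanism \(G\) and belief \(\pi_1\in\Pi_1\) such that \(U_1^{g'}(x')>U_1^g(x')\) for some \(x'\in X\) and \(g'\in BR(\pi_1,G)\). Here, with \(Z=\{x: U_1^{g'}(x)>U_1^g(x)\}\) and \(Z^0=\{x:U_1^{g'}(x)=U_1^g(x)\}\), \(\Pi_1\) is the set of probability distributions \(\pi_1\) on \(Z\cup Z^0\),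 extended by \(0\) to \(X\), such that \(\pi_1(x)/p_1(x)\le \pi_1(x')/p_1(x')\) for all \(x\in X\) and \(x'\in Z\). Claim. (1) If some allocation passes the FGP criterion, then every RSW allocation is undominated. (2) Every undominated RSW allocation passes the FGP criterion. (3) An allocation that passes the FGP criterion exists if and only if a strong solution exists. -/

import Mathlib

open Filter Topology

noncomputable section

namespace BilateralTrade

/-- The primitives of the trading environment. The seller's types are `Fin m` and the buyer's
types are `Fin n`, both ordered as usual. The type `x` of the seller and the type `y` of the buyer
are independent with laws `p₁`, `p₂` of full support. The seller's valuation is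
`v₁₁ x + v₁₂ y` and the buyer's valuation is `v₂₁ x + v₂₂ y`: in `vᵢⱼ` the first index is the
trader who values the good and the second one is the trader whose type is the argument. -/
structure Environment (m n : ℕ) where
  p₁ : Fin m → ℝ
  p₂ : Fin n → ℝ
  p₁_mem : p₁ ∈ stdSimplex ℝ (Fin m)
  p₂_mem : p₂ ∈ stdSimplex ℝ (Fin n)
  p₁_pos : ∀ x, 0 < p₁ x
  p₂_pos : ∀ y, 0 < p₂ y
  v₁₁ : Fin m → ℝ
  v₁₂ : Fin n → ℝ
  v₂₁ : Fin m → ℝ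
  v₂₂ : Fin n → ℝ
  v₁₁_strictMono : StrictMono v₁₁
  v₂₂_strictMono : StrictMono v₂₂
  v₁₂_mono : Monotone v₁₂
  v₂₁_mono : Monotone v₂₁
  v₁_nonneg : ∀ x y, 0 ≤ v₁₁ x + v₁₂ y
  v₂_nonneg : ∀ x y, 0 ≤ v₂₁ x + v₂₂ y

/-- An outcome function on `A × B`: a probability `q` that the good is transferred and a payment
`t` from the buyer to the seller, for every pair in `A × B`. -/
structure OutcomeFn (A B : Type) where
  q : A → B → ℝ
  t : A → B → ℝ
  q_mem : ∀ a b, q a b ∈ Set.Icc (0 : ℝ) 1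

/-- An allocation (direct mechanism) assigns an outcome to every type profile. -/
abbrev Allocation (m n : ℕ) := OutcomeFn (Fin m) (Fin n)

/-- A mechanism: a finite strategic game form between the seller (actions `S₁`) and the buyer
(actions `S₂`). A player who is inactive has exactly one action. -/
structure Mechanism where
  S₁ : Type
  S₂ : Type
  [fintype₁ : Fintype S₁]
  [fintype₂ : Fintype S₂]
  [nonempty₁ : Nonempty S₁]
  [nonempty₂ : Nonempty S₂]
  out : OutcomeFn S₁ S₂

attribute [instance] Mechanism.fintype₁ Mechanism.fintype₂
  Mechanism.nonempty₁ Mechanism.nonempty₂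

namespace Environment

variable {m n : ℕ} (E : Environment m n)

/-- The seller's ex post payoff from the outcome `(q, t)` at the type profile `(x, y)`. -/
def sellerPayoff (x : Fin m) (y : Fin n) (q t : ℝ) : ℝ :=
  t + (E.v₁₁ x + E.v₁₂ y) * (1 - q)

/-- The buyer's ex post payoff from the outcome `(q, t)` at the type profile `(x, y)`. -/
def buyerPayoff (x : Fin m) (y : Fin n) (q t : ℝ) : ℝ :=
  (E.v₂₁ x + E.v₂₂ y) * q - t

/-- The seller's interim payoff in `g` from reporting `xr` when her type is `x`. -/
def sellerReport (g : Allocation m n) (xr x : Fin m) : ℝ :=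
  ∑ y, E.p₂ y * E.sellerPayoff x y (g.q xr y) (g.t xr y)

/-- The seller's interim payoff `U₁(x)` in `g` under truth-telling. -/
def U₁ (g : Allocation m n) (x : Fin m) : ℝ :=
  E.sellerReport g x x

/-- The buyer's ex post payoff in `g` from reporting `yr` at the type profile `(x, y)`. -/
def buyerReport (g : Allocation m n) (yr : Fin n) (x : Fin m) (y : Fin n) : ℝ :=
  E.buyerPayoff x y (g.q x yr) (g.t x yr)

/-- The buyer's expected payoff in `g` from reporting `yr` when his type is `y` and his belief
about the seller's type is `π₁`. -/
def buyerReportInterim (g : Allocation m n) (π₁ : Fin m → ℝ) (yr y : Fin n) : ℝ :=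
  ∑ x, π₁ x * E.buyerReport g yr x y

/-- `g` is Bayesian incentive compatible for the seller. -/
def BICSeller (g : Allocation m n) : Prop :=
  ∀ x xr, E.sellerReport g xr x ≤ E.U₁ g x

/-- `g` is interim individually rational for the seller. -/
def IIRSeller (g : Allocation m n) : Prop :=
  ∀ x, E.v₁₁ x + ∑ y, E.p₂ y * E.v₁₂ y ≤ E.U₁ g x

/-- `g` is Bayesian incentive compatible for the buyer with belief `π₁`. -/
def BICBuyer (π₁ : Fin m → ℝ) (g : Allocation m n) : Prop :=
  ∀ y yr, E.buyerReportInterim g π₁ yr y ≤ E.buyerReportInterim g π₁ y y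

/-- `g` is interim individually rational for the buyer with belief `π₁`. -/
def IIRBuyer (π₁ : Fin m → ℝ) (g : Allocation m n) : Prop :=
  ∀ y, 0 ≤ E.buyerReportInterim g π₁ y y

/-- `g` is ex post incentive compatible for the buyer. -/
def EPICBuyer (g : Allocation m n) : Prop :=
  ∀ x y yr, E.buyerReport g yr x y ≤ E.buyerReport g y x y

/-- `g` is ex post individually rational for the buyer. -/
def EPIRBuyer (g : Allocation m n) : Prop :=
  ∀ x y, 0 ≤ E.buyerReport g y x y

/-- `g` is `π₁`-feasible. -/
def FeasibleGiven (π₁ : Fin m → ℝ) (g : Allocation m n) : Prop :=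
  E.BICSeller g ∧ E.IIRSeller g ∧ E.BICBuyer π₁ g ∧ E.IIRBuyer π₁ g

/-- `g` is feasible, i.e. feasible given the prior. -/
def Feasible (g : Allocation m n) : Prop :=
  E.FeasibleGiven E.p₁ g

/-- `g'` dominates `g`. -/
def Dominates (g' g : Allocation m n) : Prop :=
  (∀ x, E.U₁ g x ≤ E.U₁ g' x) ∧ ∃ x, E.U₁ g x < E.U₁ g' x

/-- The feasible allocation `g` is undominated given the belief `π₁`. -/
def UndominatedGiven (π₁ : Fin m → ℝ) (g : Allocation m n) : Prop :=
  E.Feasible g ∧ ¬ ∃ g', E.FeasibleGiven π₁ g' ∧ E.Dominates g' g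

/-- The feasible allocation `g` is undominated (given the prior). -/
def Undominated (g : Allocation m n) : Prop :=
  E.UndominatedGiven E.p₁ g

/-- The constraints of the problem that defines RSW allocations. -/
def RSWConstraints (g : Allocation m n) : Prop :=
  E.BICSeller g ∧ E.EPICBuyer g ∧ E.EPIRBuyer g

/-- `g` is a Rothschild–Stiglitz–Wilson allocation: for every seller type `x` it maximizes
`U₁(x)` among the allocations that are BIC for the seller and EPIC and EPIR for the buyer. -/
def IsRSW (g : Allocation m n) : Prop :=
  E.RSWConstraints g ∧ ∀ x, ∀ g', E.RSWConstraints g' → E.U₁ g' x ≤ E.U₁ g x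

/-- A strong solution: an RSW allocation that is undominated given the prior. -/
def IsStrongSolution (g : Allocation m n) : Prop :=
  E.IsRSW g ∧ E.Undominated g

/-- Bayes posterior about the buyer's type after an acceptance, for the acceptance plan `γ`. -/
def acceptPosterior (γ : Fin n → ℝ) (y : Fin n) : ℝ :=
  E.p₂ y * γ y / ∑ y', E.p₂ y' * γ y'

/-- Consistency of the seller's belief `π₂` (after an acceptance) with the buyer's acceptance plan
`γ`: the pair is a limit of totally mixed plans with their Bayes posteriors. Actions are chosen
after all moves that `π₂` is about, so perturbing the action plans puts no restriction on `π₂`. -/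
def ConsistentBelief (γ π₂ : Fin n → ℝ) : Prop :=
  ∃ γseq : ℕ → Fin n → ℝ, (∀ k y, 0 < γseq k y ∧ γseq k y < 1) ∧
    (∀ y, Tendsto (fun k => γseq k y) atTop (𝓝 (γ y))) ∧
    ∀ y, Tendsto (fun k => E.acceptPosterior (γseq k) y) atTop (𝓝 (π₂ y))

/-- Expected continuation payoff, after `G` has been accepted, of the seller of type `x` from the
action `s₁`, given her belief `π₂` and the buyer's action plan `σ₂`. -/
def sellerContinuation (G : Mechanism) (π₂ : Fin n → ℝ) (σ₂ : Fin n → G.S₂ → ℝ)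
    (x : Fin m) (s₁ : G.S₁) : ℝ :=
  ∑ y, π₂ y * ∑ s₂, σ₂ y s₂ * E.sellerPayoff x y (G.out.q s₁ s₂) (G.out.t s₁ s₂)

/-- Expected continuation payoff, after `G` has been accepted, of the buyer of type `y` from the
action `s₂`, given the belief that `(x, s₁)` has probability `π₁ x * σ₁ x s₁`. -/
def buyerContinuation (G : Mechanism) (π₁ : Fin m → ℝ) (σ₁ : Fin m → G.S₁ → ℝ)
    (y : Fin n) (s₂ : G.S₂) : ℝ :=
  ∑ x, π₁ x * ∑ s₁, σ₁ x s₁ * E.buyerPayoff x y (G.out.q s₁ s₂) (G.out.t s₁ s₂)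

/-- `(γ, σ₁, σ₂)` with the belief `π₂` is a sequential equilibrium of the continuation game in
which the mechanism `G` has been offered and the buyer believes that the seller's type has law
`π₁`: the buyer of type `y` accepts with probability `γ y` (a rejection gives the no-trade outcome
and hence the payoff `0` to the buyer); after an acceptance both players choose their actions
simultaneously. Every type of both players, also a type of probability zero, is optimizing at
each of its information sets, on and off the path. -/
structure IsSequentialEquilibrium (π₁ : Fin m → ℝ) (G : Mechanism) (γ : Fin n → ℝ)
    (σ₁ : Fin m → G.S₁ → ℝ) (σ₂ : Fin n → G.S₂ → ℝ) (π₂ : Fin n → ℝ) : Prop where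
  accept_mem : ∀ y, γ y ∈ Set.Icc (0 : ℝ) 1
  seller_mixed : ∀ x, σ₁ x ∈ stdSimplex ℝ G.S₁
  buyer_mixed : ∀ y, σ₂ y ∈ stdSimplex ℝ G.S₂
  consistent : E.ConsistentBelief γ π₂
  seller_optimal : ∀ x s₁', E.sellerContinuation G π₂ σ₂ x s₁' ≤
    ∑ s₁, σ₁ x s₁ * E.sellerContinuation G π₂ σ₂ x s₁
  buyer_optimal : ∀ y s₂', E.buyerContinuation G π₁ σ₁ y s₂' ≤
    ∑ s₂, σ₂ y s₂ * E.buyerContinuation G π₁ σ₁ y s₂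
  accept_optimal : ∀ y, ∀ a ∈ Set.Icc (0 : ℝ) 1,
    a * (∑ s₂, σ₂ y s₂ * E.buyerContinuation G π₁ σ₁ y s₂) ≤
      γ y * ∑ s₂, σ₂ y s₂ * E.buyerContinuation G π₁ σ₁ y s₂

/-- The set `BR(π₁, G)` of the allocations that are induced by the sequential equilibria of the
continuation game given `(π₁, G)`. -/
def BR (π₁ : Fin m → ℝ) (G : Mechanism) : Set (Allocation m n) :=
  {g | ∃ (γ : Fin n → ℝ) (σ₁ : Fin m → G.S₁ → ℝ) (σ₂ : Fin n → G.S₂ → ℝ) (π₂ : Fin n → ℝ),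
    E.IsSequentialEquilibrium π₁ G γ σ₁ σ₂ π₂ ∧
    (∀ x y, g.q x y = γ y * ∑ s₁, ∑ s₂, σ₁ x s₁ * σ₂ y s₂ * G.out.q s₁ s₂) ∧
    ∀ x y, g.t x y = γ y * ∑ s₁, ∑ s₂, σ₁ x s₁ * σ₂ y s₂ * G.out.t s₁ s₂}

/-- The set `Π₁` of beliefs for a deviation from `g` to `g'`: probability distributions on the
types that weakly gain, such that the likelihood ratio to the prior is at each type that strictly
gains at least as large as at any other type. -/
def credibleBeliefs (g g' : Allocation m n) : Set (Fin m → ℝ) :=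
  {π₁ | π₁ ∈ stdSimplex ℝ (Fin m) ∧
    (∀ x, ¬ (E.U₁ g x < E.U₁ g' x ∨ E.U₁ g' x = E.U₁ g x) → π₁ x = 0) ∧
    ∀ x x', E.U₁ g x' < E.U₁ g' x' → π₁ x / E.p₁ x ≤ π₁ x' / E.p₁ x'}

/-- `g` passes the Farrell–Grossman–Perry criterion. -/
def PassesFGP (g : Allocation m n) : Prop :=
  E.Feasible g ∧ ¬ ∃ g' : Allocation m n, (∃ x', E.U₁ g x' < E.U₁ g' x') ∧
    ∃ G : Mechanism, ∃ π₁ ∈ E.credibleBeliefs g g', g' ∈ E.BR π₁ G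

end Environment

end BilateralTrade

end

namespace BilateralTrade

namespace Environment

variable {m n : ℕ} (E : Environment m n)

/-! Ex post constraints for the buyer survive averaging with any nonnegative weights. Suppose a
credible deviation `g'` with belief `π₁` upsets an undominated RSW allocation `g`. Scaling the
likelihood ratio `π₁ / p₁` by its maximum gives a probability `α` that is 1 at types that gain and 0
at types that lose. Playing `g'` with probability `α` and `g` otherwise is then feasible under the
prior and dominates `g`, a contradiction (`passesFGP_of_isRSW_of_undominated`).

Conversely, let `g` pass the criterion. It is undominated, and it is weakly better for the seller
than every allocation meeting the RSW constraints, since deviations may be paired with the prior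
conditional on the strict gainers. It remains to realize its payoffs under ex post constraints. The
trade probabilities can be rearranged to be monotone in the buyer's type without changing their
marginals (`exists_monotone_sameMarginals`); the buyer then receives an information rent plus a
constant for each seller type, nonnegative on average (`Feasible.exists_schedules`). If the constant
of `x'` were positive, a pooled contract with slightly less trade would attract only types from `x'`
upwards, whose goods are worth at least as much to the buyer (`PassesFGP.const_nonpos`). So all
constants vanish, and ex post incentive compatibility and rationality follow. -/

lemma sum_p₁ : ∑ x, E.p₁ x = 1 := E.p₁_mem.2

lemma sum_p₂ : ∑ y, E.p₂ y = 1 := E.p₂_mem.2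

lemma nonempty_seller (E : Environment m n) : Nonempty (Fin m) := by
  by_contra h
  have := not_nonempty_iff.1 h
  simpa using E.sum_p₁

lemma nonempty_buyer (E : Environment m n) : Nonempty (Fin n) := by
  by_contra h
  have := not_nonempty_iff.1 h
  simpa using E.sum_p₂

/-! ### Interim payoffs of the seller -/

/-- The probability of trade expected by the seller when she reports `x`. -/
def tradeProb (g : Allocation m n) (x : Fin m) : ℝ :=
  ∑ y, E.p₂ y * g.q x y

/-- The expected payment to the seller who reports `x`, net of the part of her valuation that
depends on the buyer's type. -/
def netRevenue (g : Allocation m n) (x : Fin m) : ℝ :=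
  ∑ y, E.p₂ y * (g.t x y - E.v₁₂ y * g.q x y)

/-- The seller's interim payoff from no trade. -/
def outside (x : Fin m) : ℝ :=
  E.v₁₁ x + ∑ y, E.p₂ y * E.v₁₂ y

/-- By independence, a report matters to the seller only through two numbers, so schedules may be
changed freely as long as both are kept. -/
lemma sellerReport_eq (g : Allocation m n) (xr x : Fin m) :
    E.sellerReport g xr x =
      E.netRevenue g xr - E.v₁₁ x * E.tradeProb g xr + E.outside x := by
  have h : E.outside x = ∑ y, E.p₂ y * (E.v₁₁ x + E.v₁₂ y) := by
    simp only [outside, mul_add, Finset.sum_add_distrib, ← Finset.sum_mul, E.sum_p₂, one_mul]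
  rw [h]
  simp only [sellerReport, netRevenue, tradeProb, sellerPayoff, Finset.mul_sum,
    ← Finset.sum_sub_distrib, ← Finset.sum_add_distrib]
  exact Finset.sum_congr rfl fun y _ => by ring

/-! ### Best responses and direct mechanisms -/

/-- The mechanism in which both traders report their types. -/
def directMechanism (g : Allocation m n) : Mechanism :=
  haveI := E.nonempty_seller
  haveI := E.nonempty_buyer
  { S₁ := Fin m, S₂ := Fin n, out := g }

/-- Trembles that do not depend on the type leave the prior unchanged under Bayes' rule; `k + 2`
keeps them interior also at `k = 0`. -/
lemma consistentBelief_accept : E.ConsistentBelief (fun _ => 1) E.p₂ := by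
  refine ⟨fun k _ => 1 - 1 / ((k : ℝ) + 2), fun k y => ?_, fun y => ?_, fun y => ?_⟩
  · have h : (0 : ℝ) < (k : ℝ) + 2 := by positivity
    have h1 : 1 / ((k : ℝ) + 2) < 1 := by
      rw [div_lt_one h]; linarith [(Nat.cast_nonneg k : (0 : ℝ) ≤ k)]
    exact ⟨by linarith, by linarith [one_div_pos.2 h]⟩
  · have h : Tendsto (fun k : ℕ => 1 / ((k : ℝ) + 2)) atTop (𝓝 0) := by
      have := (tendsto_add_atTop_iff_nat 1).2 (tendsto_one_div_add_atTop_nhds_zero_nat (𝕜 := ℝ))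
      refine this.congr fun k => ?_
      push_cast
      ring
    simpa using tendsto_const_nhds.sub h
  · refine tendsto_const_nhds.congr fun k => ?_
    have h : (0 : ℝ) < (k : ℝ) + 2 := by positivity
    have h1 : 1 / ((k : ℝ) + 2) < 1 := by
      rw [div_lt_one h]; linarith [(Nat.cast_nonneg k : (0 : ℝ) ≤ k)]
    have h2 : 1 - 1 / ((k : ℝ) + 2) ≠ 0 := by linarith
    rw [acceptPosterior, ← Finset.sum_mul, E.sum_p₂, one_mul, mul_div_cancel_right₀ _ h2]

/-- An allocation that is incentive compatible for both traders and individually rational for the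
buyer is induced by truth-telling in its direct mechanism. -/
lemma mem_BR_directMechanism {π₁ : Fin m → ℝ} {g : Allocation m n} (hs : E.BICSeller g)
    (hb : E.BICBuyer π₁ g) (hi : E.IIRBuyer π₁ g) : g ∈ E.BR π₁ (E.directMechanism g) := by
  classical
  have hS : ∀ x s₁, E.sellerContinuation (E.directMechanism g) E.p₂
      (fun y => (Pi.single y 1 : Fin n → ℝ)) x s₁ = E.sellerReport g s₁ x := by
    intro x s₁
    simp only [sellerContinuation, sellerReport]
    refine Finset.sum_congr rfl fun y _ => ?_
    congr 1
    exact (Finset.sum_eq_single y (fun b _ hby => by simp [Pi.single_eq_of_ne hby])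
      (fun h => absurd (Finset.mem_univ _) h)).trans (by simp [directMechanism])
  have hB : ∀ y s₂, E.buyerContinuation (E.directMechanism g) π₁
      (fun x => (Pi.single x 1 : Fin m → ℝ)) y s₂ = E.buyerReportInterim g π₁ s₂ y := by
    intro y s₂
    simp only [buyerContinuation, buyerReportInterim]
    refine Finset.sum_congr rfl fun x _ => ?_
    congr 1
    exact (Finset.sum_eq_single x (fun b _ hbx => by simp [Pi.single_eq_of_ne hbx])
      (fun h => absurd (Finset.mem_univ _) h)).trans (by simp [directMechanism, buyerReport])
  have hsum : ∀ {k : ℕ} (i : Fin k) (f : Fin k → ℝ),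
      ∑ j, (Pi.single i 1 : Fin k → ℝ) j * f j = f i := by
    intro k i f
    exact (Finset.sum_eq_single i (fun b _ hb => by simp [Pi.single_eq_of_ne hb])
      (by simp)).trans (by simp)
  have hB' : ∀ y, ∑ s₂, (Pi.single y 1 : Fin n → ℝ) s₂ *
      E.buyerContinuation (E.directMechanism g) π₁
      (fun x => (Pi.single x 1 : Fin m → ℝ)) y s₂ = E.buyerReportInterim g π₁ y y := by
    intro y
    exact (hsum y _).trans (hB y y)
  refine ⟨fun _ => 1, fun x => (Pi.single x 1 : Fin m → ℝ),
    fun y => (Pi.single y 1 : Fin n → ℝ), E.p₂, ⟨fun _ => ⟨zero_le_one, le_rfl⟩,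
      fun x => single_mem_stdSimplex ℝ x, fun y => single_mem_stdSimplex ℝ y,
      E.consistentBelief_accept, fun x s₁ => ?_, fun y s₂ => ?_, fun y a ha => ?_⟩,
      fun x y => ?_, fun x y => ?_⟩
  · refine le_of_le_of_eq ?_ ((hsum x _).trans (hS x x)).symm
    rw [hS]
    exact hs x s₁
  · refine le_of_le_of_eq ?_ (hB' y).symm
    rw [hB]
    exact hb y s₂
  · have h := hB' y
    refine (mul_le_mul_of_nonneg_right ha.2 (le_of_le_of_eq (hi y) h.symm))
  · rw [one_mul]
    refine Eq.symm ?_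
    calc _ = ∑ s₁, (Pi.single x 1 : Fin m → ℝ) s₁ *
          ∑ s₂, (Pi.single y 1 : Fin n → ℝ) s₂ * g.q s₁ s₂ := by
            simp only [Finset.mul_sum, ← mul_assoc]; rfl
      _ = g.q x y := by rw [hsum, hsum]
  · rw [one_mul]
    refine Eq.symm ?_
    calc _ = ∑ s₁, (Pi.single x 1 : Fin m → ℝ) s₁ *
          ∑ s₂, (Pi.single y 1 : Fin n → ℝ) s₂ * g.t s₁ s₂ := by
            simp only [Finset.mul_sum, ← mul_assoc]; rfl
      _ = g.t x y := by rw [hsum, hsum]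

lemma sum_mul_le_of_mem_stdSimplex {ι : Type*} [Fintype ι] {w f : ι → ℝ} {c : ℝ}
    (hw : w ∈ stdSimplex ℝ ι) (hf : ∀ i, f i ≤ c) : ∑ i, w i * f i ≤ c :=
  calc ∑ i, w i * f i ≤ ∑ i, w i * c :=
        Finset.sum_le_sum fun i _ => mul_le_mul_of_nonneg_left (hf i) (hw.1 i)
    _ = c := by rw [← Finset.sum_mul, hw.2, one_mul]

section Induced

variable {E} {π₁ : Fin m → ℝ} {G : Mechanism} {g : Allocation m n}

lemma sum_sum_payoff {A B : Type*} [Fintype A] [Fintype B] (a : A → ℝ) (b : B → ℝ)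
    (q t : A → B → ℝ) (v : ℝ) :
    ∑ i, a i * ∑ j, b j * (v * q i j - t i j) =
      v * ∑ i, ∑ j, a i * b j * q i j - ∑ i, ∑ j, a i * b j * t i j := by
  simp only [Finset.mul_sum, ← Finset.sum_sub_distrib]
  exact Finset.sum_congr rfl fun i _ => Finset.sum_congr rfl fun j _ => by ring

/-- Allocations induced by sequential equilibria are incentive compatible and individually
rational for the buyer. -/
lemma buyer_of_mem_BR (h : g ∈ E.BR π₁ G) : E.BICBuyer π₁ g ∧ E.IIRBuyer π₁ g := by
  obtain ⟨γ, σ₁, σ₂, π₂, hSE, hq, ht⟩ := h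
  have key : ∀ y yr, E.buyerReportInterim g π₁ yr y =
      γ yr * ∑ s₂, σ₂ yr s₂ * E.buyerContinuation G π₁ σ₁ y s₂ := by
    intro y yr
    have h1 : ∑ s₂, σ₂ yr s₂ * E.buyerContinuation G π₁ σ₁ y s₂ =
        ∑ x, π₁ x * ∑ s₁, σ₁ x s₁ * ∑ s₂, σ₂ yr s₂ *
          ((E.v₂₁ x + E.v₂₂ y) * G.out.q s₁ s₂ - G.out.t s₁ s₂) := by
      simp only [buyerContinuation, buyerPayoff, Finset.mul_sum]
      rw [Finset.sum_comm]
      refine Finset.sum_congr rfl fun x _ => ?_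
      rw [Finset.sum_comm]
      exact Finset.sum_congr rfl fun i _ => Finset.sum_congr rfl fun j _ => by ring
    rw [h1, buyerReportInterim, Finset.mul_sum]
    refine Finset.sum_congr rfl fun x _ => ?_
    rw [sum_sum_payoff, buyerReport, buyerPayoff, hq, ht]
    ring
  refine ⟨fun y yr => ?_, fun y => ?_⟩
  · rw [key, key]
    -- Imitating `yr` is undone in two stages: first the action plan is improved, then the
    -- acceptance decision.
    calc _ ≤ γ yr * ∑ s₂, σ₂ y s₂ * E.buyerContinuation G π₁ σ₁ y s₂ :=
          mul_le_mul_of_nonneg_left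
            (sum_mul_le_of_mem_stdSimplex (hSE.buyer_mixed yr) (hSE.buyer_optimal y))
            (hSE.accept_mem yr).1
      _ ≤ _ := hSE.accept_optimal y _ (hSE.accept_mem yr)
  · rw [key]
    simpa using hSE.accept_optimal y 0 ⟨le_rfl, zero_le_one⟩

lemma ConsistentBelief.eq_acceptPosterior {γ π₂ : Fin n → ℝ} (h : E.ConsistentBelief γ π₂)
    (hP : ∑ y, E.p₂ y * γ y ≠ 0) (y : Fin n) : π₂ y = E.acceptPosterior γ y := by
  obtain ⟨γs, -, hγ, hπ⟩ := h
  refine tendsto_nhds_unique (hπ y) ?_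
  exact ((hγ y).const_mul _).div
    (tendsto_finsetSum _ fun y' _ => (hγ y').const_mul _) hP

/-- Allocations induced by sequential equilibria are Bayesian incentive compatible for the
seller. -/
lemma bicSeller_of_mem_BR (h : g ∈ E.BR π₁ G) : E.BICSeller g := by
  obtain ⟨γ, σ₁, σ₂, π₂, hSE, hq, ht⟩ := h
  set P := ∑ y, E.p₂ y * γ y with hP
  have hnn : ∀ y, 0 ≤ E.p₂ y * γ y := fun y =>
    mul_nonneg (E.p₂_pos y).le (hSE.accept_mem y).1
  have hP0 : 0 ≤ P := Finset.sum_nonneg fun y _ => hnn y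
  rcases hP0.eq_or_lt with h0 | hpos
  -- If acceptance has probability zero, `π₂` is off the path, but all reports lead to no trade.
  · have hγ : ∀ y, γ y = 0 := fun y => by
      have := (Finset.sum_eq_zero_iff_of_nonneg fun y _ => hnn y).1 h0.symm y (Finset.mem_univ y)
      exact (mul_eq_zero.1 this).resolve_left (E.p₂_pos y).ne'
    intro x xr
    simp [U₁, sellerReport, hq, ht, hγ]
  · have hπ : ∀ y, E.p₂ y * γ y = P * π₂ y := fun y => by
      rw [hSE.consistent.eq_acceptPosterior hpos.ne' y, acceptPosterior, ← hP]
      field_simp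
    -- By Bayes' rule, a report affects the interim payoff only through `P` times the continuation
    -- payoff.
    have key : ∀ xr x, E.sellerReport g xr x =
        P * ∑ s₁, σ₁ xr s₁ * E.sellerContinuation G π₂ σ₂ x s₁ +
          ∑ y, E.p₂ y * (1 - γ y) * (E.v₁₁ x + E.v₁₂ y) := by
      intro xr x
      have h1 : ∑ s₁, σ₁ xr s₁ * E.sellerContinuation G π₂ σ₂ x s₁ =
          ∑ y, π₂ y * ∑ s₁, σ₁ xr s₁ * ∑ s₂, σ₂ y s₂ *
            ((E.v₁₁ x + E.v₁₂ y) * (1 - G.out.q s₁ s₂) - (- G.out.t s₁ s₂)) := by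
        simp only [sellerContinuation, sellerPayoff, Finset.mul_sum]
        rw [Finset.sum_comm]
        exact Finset.sum_congr rfl fun y _ => Finset.sum_congr rfl fun i _ =>
          Finset.sum_congr rfl fun j _ => by ring
      rw [h1, Finset.mul_sum, sellerReport, ← Finset.sum_add_distrib]
      refine Finset.sum_congr rfl fun y _ => ?_
      have h2 : ∑ i, ∑ j, σ₁ xr i * σ₂ y j * (1 - G.out.q i j) =
          1 - ∑ i, ∑ j, σ₁ xr i * σ₂ y j * G.out.q i j := by
        simp only [mul_sub, mul_one, Finset.sum_sub_distrib]
        rw [← Finset.sum_mul_sum, (hSE.seller_mixed xr).2, (hSE.buyer_mixed y).2, one_mul]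
      rw [← mul_assoc, ← hπ, sum_sum_payoff, h2, sellerPayoff, hq, ht]
      simp only [mul_neg, Finset.sum_neg_distrib]
      ring
    intro x xr
    rw [U₁, key, key]
    exact add_le_add_left (mul_le_mul_of_nonneg_left
      (sum_mul_le_of_mem_stdSimplex (hSE.seller_mixed xr) (hSE.seller_optimal x)) hP0) _

end Induced

end Environment

end BilateralTrade

namespace BilateralTrade

/-! ### Schedules that are monotone in the buyer's type -/

/-- The matrices with entries in `[0, 1]` that have the same weighted row and column sums
as `q`. -/
def sameMarginals {m n : ℕ} (a : Fin m → ℝ) (b : Fin n → ℝ) (q : Fin m → Fin n → ℝ) :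
    Set (Fin m → Fin n → ℝ) :=
  {r | (∀ x y, r x y ∈ Set.Icc (0 : ℝ) 1) ∧
    (∀ y, ∑ x, a x * r x y = ∑ x, a x * q x y) ∧ ∀ x, ∑ y, b y * r x y = ∑ y, b y * q x y}

lemma isCompact_sameMarginals {m n : ℕ} (a : Fin m → ℝ) (b : Fin n → ℝ)
    (q : Fin m → Fin n → ℝ) : IsCompact (sameMarginals a b q) := by
  have h : IsCompact (Set.univ.pi fun _ : Fin m => Set.univ.pi fun _ : Fin n =>
      Set.Icc (0 : ℝ) 1) :=
    isCompact_univ_pi fun _ => isCompact_univ_pi fun _ => isCompact_Icc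
  refine h.of_isClosed_subset ?_ fun r hr x _ y _ => hr.1 x y
  simp only [sameMarginals, Set.ofPred_and, Set.ofPred_forall]
  refine (isClosed_iInter fun x => isClosed_iInter fun y => ?_).inter
    ((isClosed_iInter fun y => ?_).inter (isClosed_iInter fun x => ?_))
  · exact isClosed_Icc.preimage (by fun_prop)
  · exact isClosed_eq (by fun_prop) continuous_const
  · exact isClosed_eq (by fun_prop) continuous_const

/-- If the column sums of `q` are monotone, then some matrix with the same marginals is
monotone along each row. -/
lemma exists_monotone_sameMarginals {m n : ℕ} {a : Fin m → ℝ} {b : Fin n → ℝ}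
    (ha : ∀ x, 0 < a x) (hb : ∀ y, 0 < b y) {q : Fin m → Fin n → ℝ}
    (hq : ∀ x y, q x y ∈ Set.Icc (0 : ℝ) 1) (hmono : Monotone fun y => ∑ x, a x * q x y) :
    ∃ r ∈ sameMarginals a b q, ∀ x, Monotone (r x) := by
  classical
  -- At a minimizer of the weighted sum of squares, a decrease along a row would leave room for an
  -- exchange that lowers the sum.
  obtain ⟨r, hr, hmin⟩ := (isCompact_sameMarginals a b q).exists_isMinOn
    ⟨q, hq, fun _ => rfl, fun _ => rfl⟩
    (f := fun r => ∑ x, ∑ y, a x * b y * r x y ^ 2) (by fun_prop)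
  refine ⟨r, hr, fun x₁ y₁ y₂ hy => ?_⟩
  by_contra! hlt
  have hyne : y₁ ≠ y₂ := fun h => by simp [h] at hlt
  -- Monotone column sums force another row to compensate for the decrease in row `x₁`.
  obtain ⟨x₂, hx₂⟩ : ∃ x₂, r x₂ y₁ < r x₂ y₂ := by
    by_contra! hall
    have : ∑ x, a x * r x y₂ < ∑ x, a x * r x y₁ :=
      Finset.sum_lt_sum (fun x _ => mul_le_mul_of_nonneg_left (hall x) (ha x).le)
        ⟨x₁, Finset.mem_univ _, mul_lt_mul_of_pos_left hlt (ha x₁)⟩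
    rw [hr.2.1, hr.2.1] at this
    exact absurd (hmono hy) (not_le.2 this)
  have hxne : x₁ ≠ x₂ := fun h => by rw [h] at hlt; exact lt_asymm hlt hx₂
  -- the direction of an exchange between the rows `x₁`, `x₂` and the columns `y₁`, `y₂`
  let e : Fin m → ℝ := Pi.single x₂ (a x₂)⁻¹ - Pi.single x₁ (a x₁)⁻¹
  let f : Fin n → ℝ := Pi.single y₁ (b y₁)⁻¹ - Pi.single y₂ (b y₂)⁻¹
  have sum_e : ∀ w : Fin m → ℝ, ∑ x, a x * (e x * w x) = w x₂ - w x₁ := by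
    intro w
    simp only [e, Pi.sub_apply, sub_mul, mul_sub, Finset.sum_sub_distrib, Pi.single_apply,
      ite_mul, mul_ite, zero_mul, mul_zero, Finset.sum_ite_eq', Finset.mem_univ, if_true]
    rw [mul_inv_cancel_left₀ (ha _).ne', mul_inv_cancel_left₀ (ha _).ne']
  have sum_f : ∀ w : Fin n → ℝ, ∑ y, b y * (f y * w y) = w y₁ - w y₂ := by
    intro w
    simp only [f, Pi.sub_apply, sub_mul, mul_sub, Finset.sum_sub_distrib, Pi.single_apply,
      ite_mul, mul_ite, zero_mul, mul_zero, Finset.sum_ite_eq', Finset.mem_univ, if_true]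
    rw [mul_inv_cancel_left₀ (hb _).ne', mul_inv_cancel_left₀ (hb _).ne']
  have hslope : ∑ x, ∑ y, a x * b y * (e x * f y * r x y) < 0 := by
    have : ∑ x, ∑ y, a x * b y * (e x * f y * r x y) =
        ∑ x, a x * (e x * ∑ y, b y * (f y * r x y)) := by
      simp only [Finset.mul_sum]
      exact Finset.sum_congr rfl fun i _ => Finset.sum_congr rfl fun j _ => by ring
    rw [this]
    simp only [sum_f]
    rw [sum_e fun x => r x y₁ - r x y₂]
    linarith
  have e1 : e x₁ < 0 := by
    simp [e, Pi.single_eq_of_ne hxne, ha x₁]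
  have e2 : 0 < e x₂ := by
    simp [e, Pi.single_eq_of_ne hxne.symm, ha x₂]
  have f1 : 0 < f y₁ := by
    simp [f, Pi.single_eq_of_ne hyne, hb y₁]
  have f2 : f y₂ < 0 := by
    simp [f, Pi.single_eq_of_ne hyne.symm, hb y₂]
  have e0 : ∀ x, x ≠ x₁ → x ≠ x₂ → e x = 0 := fun x h1 h2 => by
    simp [e, Pi.single_eq_of_ne h1, Pi.single_eq_of_ne h2]
  have f0 : ∀ y, y ≠ y₁ → y ≠ y₂ → f y = 0 := fun y h1 h2 => by
    simp [f, Pi.single_eq_of_ne h1, Pi.single_eq_of_ne h2]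
  -- The strict inequalities `hlt` and `hx₂` leave room in all four cells that the exchange moves.
  have hIcc : ∀ x y, (0 < e x * f y → r x y < 1) ∧ (e x * f y < 0 → 0 < r x y) := by
    intro x y
    have b11 := hr.1 x₁ y₁
    have b12 := hr.1 x₁ y₂
    have b21 := hr.1 x₂ y₁
    have b22 := hr.1 x₂ y₂
    by_cases hx1 : x = x₁
    · subst hx1
      by_cases hy1 : y = y₁
      · subst hy1
        exact ⟨fun h => absurd (mul_neg_of_neg_of_pos e1 f1) (not_lt.2 h.le),
          fun _ => b12.1.trans_lt hlt⟩
      by_cases hy2 : y = y₂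
      · subst hy2
        exact ⟨fun _ => hlt.trans_le b11.2,
          fun h => absurd (mul_pos_of_neg_of_neg e1 f2) (not_lt.2 h.le)⟩
      simp [f0 y hy1 hy2]
    by_cases hx2 : x = x₂
    · subst hx2
      by_cases hy1 : y = y₁
      · subst hy1
        exact ⟨fun _ => hx₂.trans_le b22.2,
          fun h => absurd (mul_pos e2 f1) (not_lt.2 h.le)⟩
      by_cases hy2 : y = y₂
      · subst hy2
        exact ⟨fun h => absurd (mul_neg_of_pos_of_neg e2 f2) (not_lt.2 h.le),
          fun _ => b21.1.trans_lt hx₂⟩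
      simp [f0 y hy1 hy2]
    simp [e0 x hx1 hx2]
  have hcont : ∀ c d : ℝ, Tendsto (fun δ : ℝ => c + δ * d) (𝓝[>] 0) (𝓝 c) := fun c d => by
    have : Tendsto (fun δ : ℝ => c + δ * d) (𝓝 0) (𝓝 (c + 0 * d)) :=
      Continuous.tendsto (by fun_prop) 0
    rw [zero_mul, add_zero] at this
    exact this.mono_left nhdsWithin_le_nhds
  have hev : ∀ᶠ δ : ℝ in 𝓝[>] 0, ∀ x y, r x y + δ * (e x * f y) ∈ Set.Icc (0 : ℝ) 1 := by
    refine eventually_all.2 fun x => eventually_all.2 fun y => ?_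
    rcases lt_trichotomy (e x * f y) 0 with h | h | h
    · filter_upwards [(hcont _ _).eventually (lt_mem_nhds ((hIcc x y).2 h)),
        self_mem_nhdsWithin] with δ h1 h2
      exact ⟨h1.le, by nlinarith [(hr.1 x y).2, mul_neg_of_pos_of_neg (Set.mem_Ioi.1 h2) h]⟩
    · exact Eventually.of_forall fun δ => by simpa [h] using hr.1 x y
    · filter_upwards [(hcont _ _).eventually (gt_mem_nhds ((hIcc x y).1 h)),
        self_mem_nhdsWithin] with δ h1 h2
      exact ⟨by nlinarith [(hr.1 x y).1, mul_pos (Set.mem_Ioi.1 h2) h], h1.le⟩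
  have hneg : ∀ᶠ δ : ℝ in 𝓝[>] 0,
      2 * ∑ x, ∑ y, a x * b y * (e x * f y * r x y) +
        δ * ∑ x, ∑ y, a x * b y * (e x * f y) ^ 2 < 0 :=
    (hcont _ _).eventually (gt_mem_nhds (by linarith))
  obtain ⟨δ, h1, h2, h3⟩ := (hev.and (hneg.and self_mem_nhdsWithin)).exists
  have hmem : (fun x y => r x y + δ * (e x * f y)) ∈ sameMarginals a b q := by
    refine ⟨h1, fun y => ?_, fun x => ?_⟩
    · rw [← hr.2.1 y]
      have := sum_e fun _ => δ * f y
      rw [sub_self] at this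
      calc _ = ∑ x, a x * r x y + ∑ x, a x * (e x * (δ * f y)) := by
            rw [← Finset.sum_add_distrib]
            exact Finset.sum_congr rfl fun x _ => by ring
        _ = _ := by rw [this, add_zero]
    · rw [← hr.2.2 x]
      have := sum_f fun _ => δ * e x
      rw [sub_self] at this
      calc _ = ∑ y, b y * r x y + ∑ y, b y * (f y * (δ * e x)) := by
            rw [← Finset.sum_add_distrib]
            exact Finset.sum_congr rfl fun x _ => by ring
        _ = _ := by rw [this, add_zero]
  have hle := hmin hmem
  simp only [Set.mem_ofPred_eq] at hle
  have hexp : ∑ x, ∑ y, a x * b y * (r x y + δ * (e x * f y)) ^ 2 =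
      ∑ x, ∑ y, a x * b y * r x y ^ 2 + δ * (2 * ∑ x, ∑ y, a x * b y * (e x * f y * r x y) +
        δ * ∑ x, ∑ y, a x * b y * (e x * f y) ^ 2) := by
    simp only [Finset.mul_sum, ← Finset.sum_add_distrib]
    exact Finset.sum_congr rfl fun i _ => Finset.sum_congr rfl fun j _ => by ring
  rw [hexp] at hle
  linarith [mul_neg_of_pos_of_neg (Set.mem_Ioi.1 h3) h2]

/-! ### Information rents -/

/-- The information rent of type `y` with valuation `v` under the schedule `q`. -/
def rent {n : ℕ} (v q : Fin n → ℝ) (y : Fin n) : ℝ :=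
  ∑ k : Fin n, if h : k.1 + 1 ≤ y.1 then (v ⟨k.1 + 1, h.trans_lt y.2⟩ - v k) * q k else 0

section Rent

variable {n : ℕ} {v q : Fin n → ℝ}

lemma rent_smul (v q : Fin n → ℝ) (c : ℝ) (y : Fin n) :
    rent v (fun k => c * q k) y = c * rent v q y := by
  simp only [rent, Finset.mul_sum]
  refine Finset.sum_congr rfl fun k _ => ?_
  split_ifs
  · ring
  · simp

lemma sum_mul_rent {m : ℕ} (v : Fin n → ℝ) (a : Fin m → ℝ) (r : Fin m → Fin n → ℝ)
    (y : Fin n) : ∑ x, a x * rent v (r x) y = rent v (fun k => ∑ x, a x * r x k) y := by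
  simp only [rent, Finset.mul_sum]
  rw [Finset.sum_comm]
  refine Finset.sum_congr rfl fun k _ => ?_
  split_ifs
  · exact Finset.sum_congr rfl fun x _ => by ring
  · simp

lemma rent_nonneg (hv : Monotone v) (hq : ∀ y, 0 ≤ q y) (y : Fin n) : 0 ≤ rent v q y := by
  refine Finset.sum_nonneg fun k _ => ?_
  split_ifs
  · exact mul_nonneg (sub_nonneg.2 (hv (by rw [Fin.le_def]; exact Nat.le_succ _))) (hq k)
  · exact le_rfl

lemma rent_zero (v q : Fin n → ℝ) (h : 0 < n) : rent v q ⟨0, h⟩ = 0 := by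
  simp [rent]

lemma rent_succ (v q : Fin n → ℝ) {k : ℕ} (h : k + 1 < n) :
    rent v q ⟨k + 1, h⟩ = rent v q ⟨k, by omega⟩ +
      (v ⟨k + 1, h⟩ - v ⟨k, by omega⟩) * q ⟨k, by omega⟩ := by
  rw [rent, rent, ← sub_eq_iff_eq_add', ← Finset.sum_sub_distrib]
  rw [Finset.sum_eq_single (⟨k, by omega⟩ : Fin n)]
  · simp
  · intro j _ hj
    have hj' : j.1 ≠ k := fun hjk => hj (Fin.ext hjk)
    by_cases h1 : j.1 + 1 ≤ k
    · have h2 : j.1 + 1 ≤ k + 1 := by omega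
      simp only [h1, h2, dite_true, sub_self]
    · have h2 : ¬ j.1 + 1 ≤ k + 1 := by omega
      simp only [h1, h2, dite_false, sub_self]
  · simp

lemma rent_ic (hv : Monotone v) (hq : Monotone q) (y z : Fin n) :
    (v y - v z) * q z + rent v q z ≤ rent v q y := by
  rcases le_total z y with hzy | hyz
  · obtain ⟨j, hj⟩ := y
    obtain ⟨i, hi⟩ := z
    have hij : i ≤ j := hzy
    clear hzy
    induction j, hij using Nat.le_induction with
    | base => simp
    | succ k hik ih =>
      have h1 := ih (by omega)
      have h2 : q ⟨i, hi⟩ ≤ q ⟨k, by omega⟩ := hq hik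
      have h3 : v ⟨k, by omega⟩ ≤ v ⟨k + 1, hj⟩ := hv (Nat.le_succ k)
      rw [rent_succ]
      nlinarith [mul_nonneg (sub_nonneg.2 h2) (sub_nonneg.2 h3)]
  · obtain ⟨j, hj⟩ := z
    obtain ⟨i, hi⟩ := y
    have hij : i ≤ j := hyz
    clear hyz
    -- The multiplier is freed from `q z`, so that it stays fixed while the induction moves `z`.
    suffices H : ∀ c, q ⟨j, hj⟩ ≤ c →
        (v ⟨i, hi⟩ - v ⟨j, hj⟩) * c + rent v q ⟨j, hj⟩ ≤ rent v q ⟨i, hi⟩ from H _ le_rfl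
    induction j, hij using Nat.le_induction with
    | base => simp
    | succ k hik ih =>
      intro c hc
      have h2 : q ⟨k, by omega⟩ ≤ q ⟨k + 1, hj⟩ := hq (Nat.le_succ k)
      have h3 : v ⟨k, by omega⟩ ≤ v ⟨k + 1, hj⟩ := hv (Nat.le_succ k)
      have h1 := ih (by omega) c (h2.trans hc)
      rw [rent_succ]
      nlinarith [mul_nonneg (sub_nonneg.2 (h2.trans hc)) (sub_nonneg.2 h3)]

/-- Adding up the constraints that no type imitates the one just below bounds every incentive
compatible, nonnegative payoff. -/
lemma rent_le {b : Fin n → ℝ} (hb : ∀ y, 0 ≤ b y)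
    (hic : ∀ y z, (v y - v z) * q z + b z ≤ b y) (y : Fin n) : rent v q y ≤ b y := by
  obtain ⟨j, hj⟩ := y
  induction j with
  | zero => rw [rent_zero]; exact hb _
  | succ k ih =>
    rw [rent_succ]
    linarith [ih (by omega), hic ⟨k + 1, hj⟩ ⟨k, by omega⟩]

lemma monotone_of_ic {b : Fin n → ℝ} (hv : StrictMono v)
    (hic : ∀ y z, (v y - v z) * q z + b z ≤ b y) : Monotone q := by
  intro y z hyz
  rcases hyz.eq_or_lt with rfl | hlt
  · exact le_rfl
  · have h : 0 < v z - v y := sub_pos.2 (hv hlt)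
    by_contra! hc
    nlinarith [hic y z, hic z y, mul_pos h (sub_pos.2 hc)]

end Rent

end BilateralTrade

namespace BilateralTrade

namespace Environment

variable {m n : ℕ} {E : Environment m n}

/-! ### Undominated RSW allocations pass the criterion -/

/-- The weights need not sum to 1: below, this is applied to the part of the prior that is left over
by a deviation. -/
lemma RSWConstraints.bicBuyer {g : Allocation m n} (h : E.RSWConstraints g) {π₁ : Fin m → ℝ}
    (hπ : ∀ x, 0 ≤ π₁ x) : E.BICBuyer π₁ g := fun y yr =>
  Finset.sum_le_sum fun x _ => mul_le_mul_of_nonneg_left (h.2.1 x y yr) (hπ x)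

lemma RSWConstraints.iirBuyer {g : Allocation m n} (h : E.RSWConstraints g) {π₁ : Fin m → ℝ}
    (hπ : ∀ x, 0 ≤ π₁ x) : E.IIRBuyer π₁ g := fun y =>
  Finset.sum_nonneg fun x _ => mul_nonneg (hπ x) (h.2.2 x y)

/-- The allocation in which the outcome of `g'` is chosen with probability `α x` and the outcome
of `g` otherwise. -/
def mixture (α : Fin m → ℝ) (hα : ∀ x, α x ∈ Set.Icc (0 : ℝ) 1) (g' g : Allocation m n) :
    Allocation m n where
  q x y := α x * g'.q x y + (1 - α x) * g.q x y
  t x y := α x * g'.t x y + (1 - α x) * g.t x y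
  q_mem x y := convex_Icc (0 : ℝ) 1 (g'.q_mem x y) (g.q_mem x y) (hα x).1
    (sub_nonneg.2 (hα x).2) (add_sub_cancel _ _)

lemma sellerReport_mixture (α : Fin m → ℝ) (hα : ∀ x, α x ∈ Set.Icc (0 : ℝ) 1)
    (g' g : Allocation m n) (xr x : Fin m) :
    E.sellerReport (mixture α hα g' g) xr x =
      α xr * E.sellerReport g' xr x + (1 - α xr) * E.sellerReport g xr x := by
  simp only [sellerReport, sellerPayoff, mixture, Finset.mul_sum, ← Finset.sum_add_distrib]
  exact Finset.sum_congr rfl fun y _ => by ring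

lemma buyerReport_mixture (α : Fin m → ℝ) (hα : ∀ x, α x ∈ Set.Icc (0 : ℝ) 1)
    (g' g : Allocation m n) (yr : Fin n) (x : Fin m) (y : Fin n) :
    E.buyerReport (mixture α hα g' g) yr x y =
      α x * E.buyerReport g' yr x y + (1 - α x) * E.buyerReport g yr x y := by
  simp only [buyerReport, buyerPayoff, mixture]
  ring

/-- A mixture of incentive compatible allocations that gives every type of the seller the better one
of her two payoffs is incentive compatible. -/
lemma mixture_seller {α : Fin m → ℝ} {hα : ∀ x, α x ∈ Set.Icc (0 : ℝ) 1}
    {g' g : Allocation m n} (h' : E.BICSeller g') (h : E.BICSeller g)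
    (hU : ∀ x, E.U₁ (mixture α hα g' g) x = max (E.U₁ g' x) (E.U₁ g x)) :
    E.BICSeller (mixture α hα g' g) := by
  intro x xr
  rw [hU, sellerReport_mixture]
  have h1 := (h' x xr).trans (le_max_left _ (E.U₁ g x))
  have h2 := (h x xr).trans (le_max_right (E.U₁ g' x) _)
  nlinarith [mul_le_mul_of_nonneg_left h1 (hα xr).1,
    mul_le_mul_of_nonneg_left h2 (sub_nonneg.2 (hα xr).2)]

theorem passesFGP_of_isRSW_of_undominated {g : Allocation m n} (hR : E.IsRSW g)
    (hU : E.Undominated g) : E.PassesFGP g := by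
  refine ⟨hU.1, ?_⟩
  rintro ⟨g', ⟨x', hx'⟩, G, π₁, ⟨hπ, hsupp, hratio⟩, hBR⟩
  have hs' := bicSeller_of_mem_BR hBR
  obtain ⟨hb', hi'⟩ := buyer_of_mem_BR hBR
  -- Since `x'` gains strictly, this is the largest likelihood ratio.
  set κ := π₁ x' / E.p₁ x' with hκ
  have hle : ∀ x, π₁ x ≤ κ * E.p₁ x := fun x =>
    (div_le_iff₀ (E.p₁_pos x)).1 (hratio x x' hx')
  have hκpos : 0 < κ := by
    have h1 : ∑ x, π₁ x ≤ ∑ x, κ * E.p₁ x := Finset.sum_le_sum fun x _ => hle x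
    rw [hπ.2, ← Finset.mul_sum, E.sum_p₁, mul_one] at h1
    linarith
  let α : Fin m → ℝ := fun x => π₁ x / (κ * E.p₁ x)
  have hden : ∀ x, 0 < κ * E.p₁ x := fun x => mul_pos hκpos (E.p₁_pos x)
  have hα : ∀ x, α x ∈ Set.Icc (0 : ℝ) 1 := fun x =>
    ⟨div_nonneg (hπ.1 x) (hden x).le, (div_le_one (hden x)).2 (hle x)⟩
  have hαp : ∀ x, E.p₁ x * α x = κ⁻¹ * π₁ x := fun x => by
    have := (E.p₁_pos x).ne'
    simp only [α]
    field_simp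
  have hα1 : ∀ x, E.U₁ g x < E.U₁ g' x → α x = 1 := fun x hx => by
    have h1 : κ ≤ π₁ x / E.p₁ x := hratio x' x hx
    rw [le_div_iff₀ (E.p₁_pos x)] at h1
    simp only [α, le_antisymm (hle x) h1]
    exact div_self (hden x).ne'
  have hα0 : ∀ x, E.U₁ g' x < E.U₁ g x → α x = 0 := fun x hx => by
    have := hsupp x (by rintro (h | h) <;> linarith)
    simp [α, this]
  let h : Allocation m n := mixture α hα g' g
  have hUh : ∀ x, E.U₁ h x = max (E.U₁ g' x) (E.U₁ g x) := fun x => by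
    have := sellerReport_mixture (E := E) α hα g' g x x
    change E.U₁ h x = α x * E.U₁ g' x + (1 - α x) * E.U₁ g x at this
    rcases lt_trichotomy (E.U₁ g x) (E.U₁ g' x) with hx | hx | hx
    · rw [this, hα1 x hx, max_eq_left hx.le]; ring
    · rw [this, hx, max_self]; ring
    · rw [this, hα0 x hx, max_eq_right hx.le]; ring
  have hrest : ∀ x, 0 ≤ E.p₁ x * (1 - α x) := fun x =>
    mul_nonneg (E.p₁_pos x).le (sub_nonneg.2 (hα x).2)
  -- The prior splits into a multiple of `π₁`, under which the buyer faces `g'`, and a remainder,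
  -- under which he faces `g`.
  have hbuy : ∀ yr y, E.buyerReportInterim h E.p₁ yr y =
      κ⁻¹ * E.buyerReportInterim g' π₁ yr y +
        E.buyerReportInterim g (fun x => E.p₁ x * (1 - α x)) yr y := by
    intro yr y
    simp only [buyerReportInterim, Finset.mul_sum, ← Finset.sum_add_distrib]
    refine Finset.sum_congr rfl fun x _ => ?_
    rw [buyerReport_mixture, ← mul_assoc, ← hαp]
    ring
  have hκinv : 0 ≤ κ⁻¹ := (inv_pos.2 hκpos).le
  refine hU.2 ⟨h, ⟨mixture_seller hs' hR.1.1 hUh, fun x => ?_, fun y yr => ?_, fun y => ?_⟩,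
    fun x => ?_, x', ?_⟩
  · rw [hUh]
    exact (hU.1.2.1 x).trans (le_max_right _ _)
  · rw [hbuy, hbuy]
    exact add_le_add (mul_le_mul_of_nonneg_left (hb' y yr) hκinv) (hR.1.bicBuyer hrest y yr)
  · rw [hbuy]
    exact add_nonneg (mul_nonneg hκinv (hi' y)) (hR.1.iirBuyer hrest y)
  · rw [hUh]
    exact le_max_right _ _
  · rw [hUh]
    exact lt_max_of_lt_left hx'

/-! ### Credible deviations -/

variable (E) in
/-- The prior conditional on the event `Z`. -/
noncomputable def condPrior (Z : Finset (Fin m)) (x : Fin m) : ℝ :=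
  if x ∈ Z then E.p₁ x / ∑ z ∈ Z, E.p₁ z else 0

lemma condPrior_mem {Z : Finset (Fin m)} (hZ : Z.Nonempty) :
    E.condPrior Z ∈ stdSimplex ℝ (Fin m) := by
  have hpos : 0 < ∑ z ∈ Z, E.p₁ z := Finset.sum_pos (fun z _ => E.p₁_pos z) hZ
  refine ⟨fun x => ?_, ?_⟩
  · unfold condPrior
    split_ifs
    · exact div_nonneg (E.p₁_pos x).le hpos.le
    · exact le_rfl
  · simp only [condPrior, Finset.sum_ite_mem, Finset.univ_inter]
    rw [← Finset.sum_div, div_self hpos.ne']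

lemma condPrior_mem_credibleBeliefs {g g' : Allocation m n} {Z : Finset (Fin m)}
    (hZ : Z.Nonempty) (h : ∀ x, x ∈ Z ↔ E.U₁ g x < E.U₁ g' x) :
    E.condPrior Z ∈ E.credibleBeliefs g g' := by
  have hpos : 0 < ∑ z ∈ Z, E.p₁ z := Finset.sum_pos (fun z _ => E.p₁_pos z) hZ
  have hval : ∀ x ∈ Z, E.condPrior Z x / E.p₁ x = (∑ z ∈ Z, E.p₁ z)⁻¹ := fun x hx => by
    have := (E.p₁_pos x).ne'
    rw [condPrior, if_pos hx]
    field_simp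
  refine ⟨condPrior_mem hZ, fun x hx => ?_, fun x x' hx' => ?_⟩
  · exact if_neg fun hxZ => hx (Or.inl ((h x).1 hxZ))
  · rw [hval x' ((h x').2 hx')]
    by_cases hxZ : x ∈ Z
    · exact (hval x hxZ).le
    · rw [condPrior, if_neg hxZ, zero_div]
      exact (inv_pos.2 hpos).le

/-- The form in which the criterion is used: direct mechanisms suffice, and the seller's individual
rationality is not needed. -/
lemma PassesFGP.le_of_credible {g g' : Allocation m n} (hg : E.PassesFGP g) {π₁ : Fin m → ℝ}
    (hπ : π₁ ∈ E.credibleBeliefs g g') (hs : E.BICSeller g') (hb : E.BICBuyer π₁ g')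
    (hi : E.IIRBuyer π₁ g') (x : Fin m) : E.U₁ g' x ≤ E.U₁ g x := by
  by_contra! hx
  exact hg.2 ⟨g', ⟨x, hx⟩, _, π₁, hπ, E.mem_BR_directMechanism hs hb hi⟩

/-- When every type weakly gains, the prior itself is a credible belief. -/
lemma PassesFGP.undominated {g : Allocation m n} (hg : E.PassesFGP g) : E.Undominated g := by
  refine ⟨hg.1, ?_⟩
  rintro ⟨g', hf, hle, x, hx⟩
  refine absurd (hg.le_of_credible ⟨E.p₁_mem, fun z hz => ?_, fun z z' _ => ?_⟩
    hf.1 hf.2.2.1 hf.2.2.2 x) (not_le.2 hx)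
  · exact absurd ((hle z).lt_or_eq.imp_right Eq.symm) hz
  · rw [div_self (E.p₁_pos z).ne', div_self (E.p₁_pos z').ne']

lemma PassesFGP.le_of_rswConstraints {g g' : Allocation m n} (hg : E.PassesFGP g)
    (h : E.RSWConstraints g') (x : Fin m) : E.U₁ g' x ≤ E.U₁ g x := by
  classical
  by_contra! hx
  have hZ : (Finset.univ.filter fun z => E.U₁ g z < E.U₁ g' z).Nonempty :=
    ⟨x, by simpa using hx⟩
  have hπ := (condPrior_mem (E := E) hZ).1
  exact absurd (hg.le_of_credible (condPrior_mem_credibleBeliefs hZ fun z => by simp)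
    h.1 (h.bicBuyer hπ) (h.iirBuyer hπ) x) (not_le.2 hx)

/-! ### Allocations with given schedules -/

variable (E) in
/-- The allocation with trade probabilities `r` in which a buyer who attaches the value `w x` to
the seller's type `x` obtains his information rent and the constant `β x`. -/
def rentAllocation (r : Fin m → Fin n → ℝ) (hr : ∀ x y, r x y ∈ Set.Icc (0 : ℝ) 1)
    (w β : Fin m → ℝ) : Allocation m n where
  q := r
  t x y := (w x + E.v₂₂ y) * r x y - rent E.v₂₂ (r x) y - β x
  q_mem := hr

variable (E) in
/-- The part of the expected virtual surplus of the schedule `s` that depends on the buyer's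
type. -/
def virtualSurplus (s : Fin n → ℝ) : ℝ :=
  ∑ y, E.p₂ y * ((E.v₂₂ y - E.v₁₂ y) * s y - rent E.v₂₂ s y)

lemma virtualSurplus_smul (c : ℝ) (s : Fin n → ℝ) :
    E.virtualSurplus (fun y => c * s y) = c * E.virtualSurplus s := by
  simp only [virtualSurplus, rent_smul, Finset.mul_sum]
  exact Finset.sum_congr rfl fun y _ => by ring

section RentAllocation

variable {r : Fin m → Fin n → ℝ} {hr : ∀ x y, r x y ∈ Set.Icc (0 : ℝ) 1} {w β : Fin m → ℝ}

lemma netRevenue_rentAllocation (x : Fin m) :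
    E.netRevenue (E.rentAllocation r hr w β) x =
      w x * ∑ y, E.p₂ y * r x y + E.virtualSurplus (r x) - β x := by
  have h : β x = ∑ y, E.p₂ y * β x := by rw [← Finset.sum_mul, E.sum_p₂, one_mul]
  rw [h]
  simp only [netRevenue, virtualSurplus, rentAllocation, Finset.mul_sum,
    ← Finset.sum_add_distrib, ← Finset.sum_sub_distrib]
  exact Finset.sum_congr rfl fun y _ => by ring

lemma buyerReport_rentAllocation (yr : Fin n) (x : Fin m) (y : Fin n) :
    E.buyerReport (E.rentAllocation r hr w β) yr x y =
      (E.v₂₁ x - w x) * r x yr +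
        ((E.v₂₂ y - E.v₂₂ yr) * r x yr + rent E.v₂₂ (r x) yr + β x) := by
  simp only [buyerReport, buyerPayoff, rentAllocation]
  ring

lemma epicBuyer_rentAllocation (hmono : ∀ x, Monotone (r x)) :
    E.EPICBuyer (E.rentAllocation r hr E.v₂₁ β) := by
  intro x y yr
  rw [buyerReport_rentAllocation, buyerReport_rentAllocation]
  linarith [rent_ic E.v₂₂_strictMono.monotone (hmono x) y yr]

lemma epirBuyer_rentAllocation (hβ : ∀ x, 0 ≤ β x) :
    E.EPIRBuyer (E.rentAllocation r hr E.v₂₁ β) := by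
  intro x y
  rw [buyerReport_rentAllocation]
  linarith [rent_nonneg E.v₂₂_strictMono.monotone (fun y => (hr x y).1) y, hβ x]

end RentAllocation

/-- Every schedule that is monotone in the buyer's type can be offered by the seller without
disclosing anything about her type, if the buyer's constant is nonnegative. -/
lemma exists_pooling {s : Fin n → ℝ} (hs : ∀ y, s y ∈ Set.Icc (0 : ℝ) 1) (hmono : Monotone s)
    {π₁ : Fin m → ℝ} (hπ : π₁ ∈ stdSimplex ℝ (Fin m)) {b : ℝ} (hb : 0 ≤ b) :
    ∃ g : Allocation m n, E.BICSeller g ∧ E.BICBuyer π₁ g ∧ E.IIRBuyer π₁ g ∧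
      ∀ x, E.U₁ g x = ((∑ z, π₁ z * E.v₂₁ z) * ∑ y, E.p₂ y * s y + E.virtualSurplus s - b)
        - E.v₁₁ x * ∑ y, E.p₂ y * s y + E.outside x := by
  set W := ∑ z, π₁ z * E.v₂₁ z
  -- The outcome ignores the seller's report, and the price uses the mean value `W`, so the errors
  -- `v₂₁ x - W` cancel under `π₁`.
  let g := E.rentAllocation (fun _ => s) (fun _ => hs) (fun _ => W) (fun _ => b)
  have hint : ∀ yr y, E.buyerReportInterim g π₁ yr y =
      (E.v₂₂ y - E.v₂₂ yr) * s yr + rent E.v₂₂ s yr + b := by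
    intro yr y
    simp only [buyerReportInterim, g, buyerReport_rentAllocation]
    simp only [mul_add (π₁ _), Finset.sum_add_distrib]
    rw [← Finset.sum_mul, ← Finset.sum_mul, ← Finset.sum_mul, hπ.2]
    have : ∑ x, π₁ x * ((E.v₂₁ x - W) * s yr) = 0 := by
      simp only [← mul_assoc, ← Finset.sum_mul, mul_sub, Finset.sum_sub_distrib, hπ.2]
      simp [W]
    rw [this]
    ring
  refine ⟨g, fun x xr => le_rfl, fun y yr => ?_, fun y => ?_, fun x => ?_⟩
  · rw [hint, hint]
    linarith [rent_ic E.v₂₂_strictMono.monotone hmono y yr]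
  · rw [hint]
    linarith [rent_nonneg E.v₂₂_strictMono.monotone (fun y => (hs y).1) y]
  · rw [U₁, sellerReport_eq, netRevenue_rentAllocation]
    rfl

/-- A feasible allocation can be described by schedules that are monotone in the buyer's type and
by constants for the buyer that are nonnegative on average. -/
lemma Feasible.exists_schedules {g : Allocation m n} (hg : E.Feasible g) :
    ∃ (r : Fin m → Fin n → ℝ) (β : Fin m → ℝ), (∀ x y, r x y ∈ Set.Icc (0 : ℝ) 1) ∧
      (∀ x, Monotone (r x)) ∧ (∀ x, ∑ y, E.p₂ y * r x y = E.tradeProb g x) ∧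
      (∀ x, E.netRevenue g x = E.v₂₁ x * E.tradeProb g x + E.virtualSurplus (r x) - β x) ∧
      0 ≤ ∑ x, E.p₁ x * β x := by
  obtain ⟨-, -, hb, hi⟩ := hg
  have hdiff : ∀ y z, E.buyerReportInterim g E.p₁ z y =
      (E.v₂₂ y - E.v₂₂ z) * ∑ x, E.p₁ x * g.q x z + E.buyerReportInterim g E.p₁ z z := by
    intro y z
    simp only [buyerReportInterim, buyerReport, buyerPayoff, Finset.mul_sum,
      ← Finset.sum_add_distrib]
    exact Finset.sum_congr rfl fun x _ => by ring
  have hic : ∀ y z, (E.v₂₂ y - E.v₂₂ z) * ∑ x, E.p₁ x * g.q x z +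
      E.buyerReportInterim g E.p₁ z z ≤ E.buyerReportInterim g E.p₁ y y := fun y z => by
    rw [← hdiff]; exact hb y z
  obtain ⟨r, ⟨hr, hcol, hrow⟩, hmono⟩ := exists_monotone_sameMarginals E.p₁_pos E.p₂_pos g.q_mem
    (monotone_of_ic E.v₂₂_strictMono hic)
  -- The constants are defined by the revenue identity; only their mean needs an argument.
  refine ⟨r, fun x => E.v₂₁ x * E.tradeProb g x + E.virtualSurplus (r x) - E.netRevenue g x, hr,
    hmono, hrow, fun x => by ring, ?_⟩
  have hcol' : ∀ c : Fin n → ℝ, ∑ x, E.p₁ x * ∑ y, E.p₂ y * (c y * r x y) =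
      ∑ x, E.p₁ x * ∑ y, E.p₂ y * (c y * g.q x y) := by
    intro c
    have : ∀ k : Fin m → Fin n → ℝ, ∑ x, E.p₁ x * ∑ y, E.p₂ y * (c y * k x y) =
        ∑ y, E.p₂ y * (c y * ∑ x, E.p₁ x * k x y) := by
      intro k
      simp only [Finset.mul_sum]
      rw [Finset.sum_comm]
      exact Finset.sum_congr rfl fun i _ => Finset.sum_congr rfl fun j _ => by ring
    rw [this, this]
    exact Finset.sum_congr rfl fun y _ => by rw [hcol]
  have hrent : ∑ x, E.p₁ x * ∑ y, E.p₂ y * rent E.v₂₂ (r x) y =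
      ∑ y, E.p₂ y * rent E.v₂₂ (fun k => ∑ x, E.p₁ x * g.q x k) y := by
    simp only [← hcol, ← sum_mul_rent, Finset.mul_sum]
    rw [Finset.sum_comm]
    exact Finset.sum_congr rfl fun i _ => Finset.sum_congr rfl fun j _ => by ring
  have hbuyer : ∑ y, E.p₂ y * E.buyerReportInterim g E.p₁ y y =
      ∑ x, E.p₁ x * ∑ y, E.p₂ y * ((E.v₂₁ x + E.v₂₂ y) * g.q x y - g.t x y) := by
    simp only [buyerReportInterim, buyerReport, buyerPayoff, Finset.mul_sum]
    rw [Finset.sum_comm]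
    exact Finset.sum_congr rfl fun i _ => Finset.sum_congr rfl fun j _ => by ring
  have hle : ∑ y, E.p₂ y * rent E.v₂₂ (fun k => ∑ x, E.p₁ x * g.q x k) y ≤
      ∑ y, E.p₂ y * E.buyerReportInterim g E.p₁ y y :=
    Finset.sum_le_sum fun y _ => mul_le_mul_of_nonneg_left (rent_le hi hic y) (E.p₂_pos y).le
  have hvs : ∀ x, E.virtualSurplus (r x) = ∑ y, E.p₂ y * ((E.v₂₂ y - E.v₁₂ y) * r x y) -
      ∑ y, E.p₂ y * rent E.v₂₂ (r x) y := fun x => by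
    simp only [virtualSurplus, ← Finset.sum_sub_distrib]
    exact Finset.sum_congr rfl fun y _ => by ring
  -- The mean constant is the buyer's expected payoff in `g` minus the expected rent of the averaged
  -- schedule, the least he can get.
  have hsum : ∑ x, E.p₁ x *
      (E.v₂₁ x * E.tradeProb g x + E.virtualSurplus (r x) - E.netRevenue g x) =
      ∑ y, E.p₂ y * E.buyerReportInterim g E.p₁ y y -
        ∑ y, E.p₂ y * rent E.v₂₂ (fun k => ∑ x, E.p₁ x * g.q x k) y := by
    calc _ = ∑ x, E.p₁ x * ∑ y, E.p₂ y * ((E.v₂₂ y - E.v₁₂ y) * r x y) -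
          ∑ x, E.p₁ x * ∑ y, E.p₂ y * rent E.v₂₂ (r x) y +
          ∑ x, E.p₁ x * (E.v₂₁ x * E.tradeProb g x - E.netRevenue g x) := by
            rw [← Finset.sum_sub_distrib, ← Finset.sum_add_distrib]
            exact Finset.sum_congr rfl fun x _ => by rw [hvs]; ring
      _ = _ := by
            rw [hcol', hrent, hbuyer]
            simp only [sub_add_eq_add_sub, ← Finset.sum_add_distrib, ← mul_add]
            congr 1
            refine Finset.sum_congr rfl fun x _ => ?_
            simp only [tradeProb, netRevenue, Finset.mul_sum, ← Finset.sum_sub_distrib,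
              ← Finset.sum_add_distrib]
            exact Finset.sum_congr rfl fun y _ => by ring
  rw [hsum]
  linarith

/-! ### No cross-subsidies -/

/-- If `g` passes the criterion, then no type of the seller leaves the buyer a positive constant:
this type and higher types would deviate to a slightly smaller probability of trade. -/
lemma PassesFGP.const_nonpos {g : Allocation m n} (hg : E.PassesFGP g) {s : Fin n → ℝ}
    (hs : ∀ y, s y ∈ Set.Icc (0 : ℝ) 1) (hmono : Monotone s) {x' : Fin m} {b : ℝ}
    (hprob : ∑ y, E.p₂ y * s y = E.tradeProb g x')
    (hrev : E.netRevenue g x' = E.v₂₁ x' * E.tradeProb g x' + E.virtualSurplus s - b) :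
    b ≤ 0 := by
  classical
  by_contra! hbpos
  set Q := E.tradeProb g x' with hQ
  have hQ0 : 0 ≤ Q := hprob ▸ Finset.sum_nonneg fun y _ => mul_nonneg (E.p₂_pos y).le (hs y).1
  -- Without trade, type `x'` would simply give away `b`, against her individual rationality.
  have hQpos : 0 < Q := by
    refine hQ0.lt_of_ne fun h0 => ?_
    have hs0 : s = fun _ => 0 := funext fun y => by
      have := (Finset.sum_eq_zero_iff_of_nonneg fun y _ =>
        mul_nonneg (E.p₂_pos y).le (hs y).1).1 (hprob.trans h0.symm) y (Finset.mem_univ y)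
      exact (mul_eq_zero.1 this).resolve_left (E.p₂_pos y).ne'
    have hv : E.virtualSurplus s = 0 := by simp [virtualSurplus, hs0, rent]
    have hir : E.outside x' ≤ E.U₁ g x' := hg.1.2.1 x'
    rw [U₁, sellerReport_eq, hrev, hv, ← hQ, ← h0] at hir
    linarith
  -- the payoff of type `x` from the report `x'`
  let line : Fin m → ℝ := fun x => E.sellerReport g x' x
  have hline : ∀ x, line x ≤ E.U₁ g x := fun x => hg.1.1 x x'
  -- Only types for which reporting `x'` is already optimal can be won over by an arbitrarily small
  -- gain.
  let Z : Finset (Fin m) := Finset.univ.filter fun x => x' ≤ x ∧ E.U₁ g x = line x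
  have hZ : Z.Nonempty := ⟨x', Finset.mem_filter.2 ⟨Finset.mem_univ _, le_rfl, rfl⟩⟩
  have hπ := condPrior_mem (E := E) hZ
  set W := ∑ z, E.condPrior Z z * E.v₂₁ z with hW
  have hWge : E.v₂₁ x' ≤ W := by
    calc E.v₂₁ x' = ∑ z, E.condPrior Z z * E.v₂₁ x' := by
          rw [← Finset.sum_mul, hπ.2, one_mul]
      _ ≤ W := Finset.sum_le_sum fun z _ => by
          by_cases hz : z ∈ Z
          · exact mul_le_mul_of_nonneg_left
              (E.v₂₁_mono (Finset.mem_filter.1 hz).2.1) (hπ.1 z)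
          · simp [condPrior, hz]
  -- The pivot: cutting trade by the fraction `ε` will change payoffs by `ε * Q * (v₁₁ x - c)`,
  -- positive exactly from `x'` upwards.
  obtain ⟨c, hc, hclt⟩ : ∃ c, (∀ x < x', E.v₁₁ x ≤ c) ∧ c < E.v₁₁ x' := by
    have : ∀ᶠ c in 𝓝[<] E.v₁₁ x', ∀ x, x < x' → E.v₁₁ x ≤ c := by
      refine eventually_all.2 fun x => ?_
      by_cases hx : x < x'
      · filter_upwards [(eventually_nhdsWithin_of_eventually_nhds
          (lt_mem_nhds (E.v₁₁_strictMono hx)))] with c hc _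
        exact hc.le
      · exact Eventually.of_forall fun c h => absurd h hx
    obtain ⟨c, h1, h2⟩ := (this.and self_mem_nhdsWithin).exists
    exact ⟨c, h1, h2⟩
  have hcont : ∀ d k : ℝ, Tendsto (fun ε : ℝ => d + ε * k) (𝓝[>] 0) (𝓝 d) := fun d k => by
    have : Tendsto (fun ε : ℝ => d + ε * k) (𝓝 0) (𝓝 (d + 0 * k)) :=
      Continuous.tendsto (by fun_prop) 0
    rw [zero_mul, add_zero] at this
    exact this.mono_left nhdsWithin_le_nhds
  -- This expression is the constant left to the buyer by the pooled contract; it is what makes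
  -- `hU'` hold.
  have hev₁ : ∀ᶠ ε : ℝ in 𝓝[>] 0,
      0 < b + (W - E.v₂₁ x') * Q + ε * (Q * c - W * Q - E.virtualSurplus s) :=
    (hcont _ _).eventually (lt_mem_nhds
      (add_pos_of_pos_of_nonneg hbpos (mul_nonneg (sub_nonneg.2 hWge) hQ0)))
  have hev₂ : ∀ᶠ ε : ℝ in 𝓝[>] 0, ∀ x, line x < E.U₁ g x →
      line x + ε * (Q * (E.v₁₁ x - c)) < E.U₁ g x := by
    refine eventually_all.2 fun x => ?_
    by_cases hx : line x < E.U₁ g x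
    · filter_upwards [(hcont (line x) (Q * (E.v₁₁ x - c))).eventually (gt_mem_nhds hx)] with ε h _
      exact h
    · exact Eventually.of_forall fun ε h => absurd h hx
  have hev₃ : ∀ᶠ ε : ℝ in 𝓝[>] 0, ε < 1 :=
    eventually_nhdsWithin_of_eventually_nhds (gt_mem_nhds zero_lt_one)
  obtain ⟨ε, h1, h2, h3, hε⟩ := (hev₁.and (hev₂.and (hev₃.and self_mem_nhdsWithin))).exists
  replace hε : 0 < ε := hε
  have hs' : ∀ y, (1 - ε) * s y ∈ Set.Icc (0 : ℝ) 1 := fun y =>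
    ⟨mul_nonneg (by linarith) (hs y).1, mul_le_one₀ (by linarith) (hs y).1 (hs y).2⟩
  obtain ⟨g', hs₁, hb', hi', hU⟩ := exists_pooling (E := E) hs'
    (fun y z hyz => mul_le_mul_of_nonneg_left (hmono hyz) (by linarith)) hπ h1.le
  have hQ' : ∑ y, E.p₂ y * ((1 - ε) * s y) = (1 - ε) * Q := by
    rw [← hprob, Finset.mul_sum]
    exact Finset.sum_congr rfl fun y _ => by ring
  have hU' : ∀ x, E.U₁ g' x = line x + ε * (Q * (E.v₁₁ x - c)) := by
    intro x
    rw [hU, hQ', virtualSurplus_smul, ← hW]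
    simp only [line]
    rw [sellerReport_eq, hrev, ← hQ]
    ring
  have hgain : ∀ x, x' ≤ x → 0 < ε * (Q * (E.v₁₁ x - c)) := fun x hx =>
    mul_pos hε (mul_pos hQpos (by linarith [E.v₁₁_strictMono.monotone hx]))
  have hZiff : ∀ x, x ∈ Z ↔ E.U₁ g x < E.U₁ g' x := by
    intro x
    rw [hU']
    constructor
    · intro hx
      obtain ⟨hx1, hx2⟩ := (Finset.mem_filter.1 hx).2
      linarith [hgain x hx1]
    · intro hx
      have hx' : x' ≤ x := by
        by_contra! hlt
        have : ε * (Q * (E.v₁₁ x - c)) ≤ 0 :=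
          mul_nonpos_of_nonneg_of_nonpos hε.le
            (mul_nonpos_of_nonneg_of_nonpos hQ0 (by linarith [hc x hlt]))
        linarith [hline x]
      refine Finset.mem_filter.2 ⟨Finset.mem_univ _, hx', ?_⟩
      by_contra hne
      exact lt_asymm hx (h2 x ((hline x).lt_of_ne (Ne.symm hne)))
  obtain ⟨z, hz⟩ := hZ
  exact absurd (hg.le_of_credible (condPrior_mem_credibleBeliefs ⟨z, hz⟩ hZiff) hs₁ hb' hi' z)
    (not_le.2 ((hZiff z).1 hz))

/-- The payoffs of an allocation that passes the criterion are attained by an RSW allocation. -/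
theorem PassesFGP.exists_isRSW {g : Allocation m n} (hg : E.PassesFGP g) :
    ∃ g', E.IsRSW g' ∧ ∀ x, E.U₁ g' x = E.U₁ g x := by
  obtain ⟨r, β, hr, hmono, hprob, hrev, hβ⟩ := Feasible.exists_schedules hg.1
  have hβ0 : ∀ x, E.p₁ x * β x ≤ 0 := fun x =>
    mul_nonpos_of_nonneg_of_nonpos (E.p₁_pos x).le
      (hg.const_nonpos (hr x) (hmono x) (hprob x) (hrev x))
  -- Nonpositive constants with a nonnegative mean all vanish.
  have hβ' : ∀ x, 0 ≤ β x := fun x => by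
    have := (Finset.sum_eq_zero_iff_of_nonpos fun x _ => hβ0 x).1
      (le_antisymm (Finset.sum_nonpos fun x _ => hβ0 x) hβ) x (Finset.mem_univ x)
    exact ((mul_eq_zero.1 this).resolve_left (E.p₁_pos x).ne').ge
  let g' := E.rentAllocation r hr E.v₂₁ β
  have hrep : ∀ xr x, E.sellerReport g' xr x = E.sellerReport g xr x := by
    intro xr x
    rw [sellerReport_eq, sellerReport_eq, netRevenue_rentAllocation, hrev, hprob]
    have : E.tradeProb g' xr = E.tradeProb g xr := hprob xr
    rw [this]
  have hU : ∀ x, E.U₁ g' x = E.U₁ g x := fun x => hrep x x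
  have hcon : E.RSWConstraints g' :=
    ⟨fun x xr => by rw [hU, hrep]; exact hg.1.1 x xr, epicBuyer_rentAllocation hmono,
      epirBuyer_rentAllocation hβ'⟩
  exact ⟨g', ⟨hcon, fun x h hh => (hg.le_of_rswConstraints hh x).trans_eq (hU x).symm⟩, hU⟩

/-- An RSW allocation pays every seller type at least as much as `g`, so whatever dominates it would
dominate `g`. -/
theorem PassesFGP.undominated_of_isRSW {g h : Allocation m n} (hg : E.PassesFGP g)
    (hh : E.IsRSW h) : E.Undominated h := by
  obtain ⟨g', hg', hU⟩ := hg.exists_isRSW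
  have hle : ∀ x, E.U₁ g x ≤ E.U₁ h x := fun x => hU x ▸ hh.2 x g' hg'.1
  have hp : ∀ x, 0 ≤ E.p₁ x := fun x => (E.p₁_pos x).le
  refine ⟨⟨hh.1.1, fun x => (hg.1.2.1 x).trans (hle x), hh.1.bicBuyer hp, hh.1.iirBuyer hp⟩, ?_⟩
  rintro ⟨k, hk, hdom, x, hx⟩
  exact hg.undominated.2 ⟨k, hk, fun z => (hle z).trans (hdom z), x, (hle x).trans_lt hx⟩

end Environment

end BilateralTrade

theorem proposition6 {m n : ℕ} (E : BilateralTrade.Environment m n) :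
    ((∃ g, E.PassesFGP g) → ∀ g, E.IsRSW g → E.Undominated g) ∧
    (∀ g, E.IsRSW g → E.Undominated g → E.PassesFGP g) ∧
    ((∃ g, E.PassesFGP g) ↔ ∃ g, E.IsStrongSolution g) := by
  refine ⟨fun ⟨g, hg⟩ h hh => hg.undominated_of_isRSW hh,
    fun g hR hU => BilateralTrade.Environment.passesFGP_of_isRSW_of_undominated hR hU,
    fun ⟨g, hg⟩ => ?_, fun ⟨g, hR, hU⟩ =>
      ⟨g, BilateralTrade.Environment.passesFGP_of_isRSW_of_undominated hR hU⟩⟩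
  obtain ⟨h, hh, -⟩ := hg.exists_isRSW
  exact ⟨h, hh, hg.undominated_of_isRSW hh⟩
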